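/- Let $q$ be a prime power, let $\mathbf{F}_q$ be the field with $q$ elements, and for $j\ge 1$ let $N(q;j)$ be the number of monic irreducible polynomials of degree $j$ over $\mathbf{F}_q$ with non-zero constant term. Fix $q$ and $t\ge 1$. For each $n$ let $C_n$ be an arbitrary coset of $\mathrm{SL}_n(q)$ in $\mathrm{GL}_n(q)$. Then, as $n\to\infty$, the proportion of elements of $C_n$ whose characteristic polynomial has no irreducible factor over $\mathbf{F}_q$ of degree at most $t$ converges to $$\prod_{j=1}^t\ \prod_{i\ge 1}\left(1-\frac{1}{q^{ij}}\right)^{N(q;j)},$$ where the infinite products over $i$ converge. The proportion of such elements in the whole group $\mathrm{GL}_n(q)$ converges to the same limit. -/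

import Mathlib

open Filter Topology
open scoped Polynomial Pointwise MatrixGroups

/-- The image of `SL_n(F)` in `GL_n(F)`, as a subgroup. -/
def slSubgroup (n : ℕ) (F : Type*) [Field F] : Subgroup (GL (Fin n) F) :=
  (Matrix.SpecialLinearGroup.toGL (n := Fin n) (R := F)).range

/-- The characteristic polynomial of `A` has no irreducible factor of degree at most `t`. -/
def NoFactorOfDegreeLE {F : Type*} [Field F] {n : ℕ} (t : ℕ) (A : GL (Fin n) F) : Prop :=
  ∀ φ : F[X], Irreducible φ → φ ∣ (A : Matrix (Fin n) (Fin n) F).charpoly → t < φ.natDegree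

/-- The proportion of elements of the finite set `C` whose characteristic polynomial has no
irreducible factor of degree at most `t`. -/
noncomputable def proportion {F : Type*} [Field F] {n : ℕ} (t : ℕ)
    (C : Set (GL (Fin n) F)) : ℝ :=
  ({A ∈ C | NoFactorOfDegreeLE t A}.ncard : ℝ) / (C.ncard : ℝ)

/-- `N(q; j)`: the number of monic irreducible polynomials of degree `j` over `F` (a field with
`q` elements) that have non-zero constant term. -/
noncomputable def numIrred (F : Type*) [Field F] (j : ℕ) : ℕ :=
  {φ : F[X] | φ.Monic ∧ Irreducible φ ∧ φ.natDegree = j ∧ φ.coeff 0 ≠ 0}.ncard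

/-- The factor `(1 - 1 / q ^ (i j)) ^ N(q; j)`, where `q` is the number of elements of `F`. -/
noncomputable def limitFactor (F : Type*) [Field F] (j i : ℕ) : ℝ :=
  (1 - 1 / (Nat.card F : ℝ) ^ (i * j)) ^ numIrred F j

/-- `∏_{j = 1}^t ∏_{i ≥ 1} (1 - 1 / q ^ (i j)) ^ N(q; j)`. -/
noncomputable def limitProduct (F : Type*) [Field F] (t : ℕ) : ℝ :=
  ∏ j ∈ Finset.Icc 1 t, ∏' i : ℕ, limitFactor F j (i + 1)

/-!
Let `A` be an invertible `n × n` matrix over `F` and view `Fⁿ` as an `F[X]`-module through `A`.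
For an irreducible `φ` of degree `d`, put `Q = q ^ d` and let `r` be the dimension of the
`φ`-torsion of `Fⁿ` over the residue field of `φ`, so that `φ` divides the characteristic
polynomial exactly when `r ≠ 0`. The module `(F[X] ⧸ φ) ^ j` embeds into `Fⁿ` in
`∏_{i < j} (Q ^ r - Q ^ i)` ways, and Euler's coefficients `e j`, defined by
`∑ j, e j * z ^ j = ∏_{i ≥ 1} (1 - z / Q ^ i)`, satisfy
`∑ j, e j * ∏_{i < j} (Q ^ r - Q ^ i) = if r = 0 then 1 else 0`.
Multiplying over all `φ ≠ X` of degree at most `t`, the indicator of the matrices without small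
factors becomes a linear combination, with coefficients independent of `A`, of the numbers of
embeddings into `Fⁿ` of fixed modules `N`.

An embedding of `N` is an injective `F`-linear map `f : N → Fⁿ` with `A ∘ f = f ∘ X`. Once
`dim N < n`, the group `SL_n` is transitive on the `m` injective maps, so a coset of `SL_n` has
a proportion `1 / m` of its matrices carrying `f` to `f ∘ X`, for each `f`: the mean number of
embeddings over the coset is `1`. For every `n` this mean is at most the index of `SL_n`, by
transitivity of `GL_n`. Dominated convergence gives the limit `∏_φ ∑ j, e j`, and Euler's identity
at `z = 1` turns it into the stated product.
-/

section EulerSeries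

/-- The coefficient of `z ^ j` in Euler's expansion of `∏_{i ≥ 1} (1 - z / Q ^ i)`, namely
`∏_{i = 1}^j 1 / (1 - Q ^ i)`. -/
def eulerCoeff {K : Type*} [Field K] (Q : K) (j : ℕ) : K :=
  ∏ i ∈ Finset.range j, (1 - Q ^ (i + 1))⁻¹

section Field

variable {K : Type*} [Field K] {Q : K}

@[simp]
theorem eulerCoeff_zero (Q : K) : eulerCoeff Q 0 = 1 :=
  Finset.prod_range_zero _

theorem eulerCoeff_succ (Q : K) (j : ℕ) :
    eulerCoeff Q (j + 1) = eulerCoeff Q j * (1 - Q ^ (j + 1))⁻¹ :=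
  Finset.prod_range_succ _ _

theorem eulerCoeff_succ_mul (hQ : ∀ i, Q ^ (i + 1) ≠ 1) (j : ℕ) :
    eulerCoeff Q (j + 1) * (1 - Q ^ (j + 1)) = eulerCoeff Q j := by
  rw [eulerCoeff_succ, inv_mul_cancel_right₀ (sub_ne_zero.2 (hQ j).symm)]

theorem sum_range_eulerCoeff_mul_prod (hQ : ∀ i, Q ^ (i + 1) ≠ 1) (z : K) (J : ℕ) :
    ∑ j ∈ Finset.range (J + 1), eulerCoeff Q j * ∏ i ∈ Finset.range j, (z - Q ^ i) =
      eulerCoeff Q J * ∏ i ∈ Finset.range J, (z - Q ^ (i + 1)) := by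
  induction J with
  | zero => simp
  | succ J ih =>
    rw [Finset.sum_range_succ, ih, Finset.prod_range_succ' fun i => z - Q ^ i,
      Finset.prod_range_succ, ← eulerCoeff_succ_mul hQ J]
    ring

theorem prod_range_pow_sub_pow_eq_zero {A : Type*} [CommRing A] (Q : A) {r j : ℕ} (h : r < j) :
    ∏ i ∈ Finset.range j, (Q ^ r - Q ^ i) = 0 :=
  Finset.prod_eq_zero (Finset.mem_range.2 h) (sub_self _)

theorem sum_range_eulerCoeff_mul_prod_pow (hQ : ∀ i, Q ^ (i + 1) ≠ 1) (r : ℕ) :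
    ∑ j ∈ Finset.range (r + 1), eulerCoeff Q j * ∏ i ∈ Finset.range j, (Q ^ r - Q ^ i) =
      if r = 0 then 1 else 0 := by
  rw [sum_range_eulerCoeff_mul_prod hQ]
  cases r with
  | zero => simp
  | succ r =>
    rw [Finset.prod_eq_zero (Finset.self_mem_range_succ r) (sub_self _), mul_zero,
      if_neg r.succ_ne_zero]

theorem hasSum_eulerCoeff_mul_prod_pow [TopologicalSpace K] (hQ : ∀ i, Q ^ (i + 1) ≠ 1) (r : ℕ) :
    HasSum (fun j => eulerCoeff Q j * ∏ i ∈ Finset.range j, (Q ^ r - Q ^ i))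
      (if r = 0 then 1 else 0) := by
  rw [← sum_range_eulerCoeff_mul_prod_pow hQ]
  refine hasSum_sum_of_ne_finset_zero fun j hj => ?_
  rw [prod_range_pow_sub_pow_eq_zero Q (by simpa [Nat.lt_succ_iff] using hj), mul_zero]

end Field

section NormedField

variable {𝕜 : Type*} [NormedField 𝕜] {Q : 𝕜}

theorem pow_succ_ne_one_of_one_lt_norm (hQ : 1 < ‖Q‖) (i : ℕ) : Q ^ (i + 1) ≠ 1 := fun h =>
  (one_lt_pow₀ hQ i.succ_ne_zero).ne' (by rw [← norm_pow, h, norm_one])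

theorem tendsto_div_pow_atTop_nhds_zero (hQ : 1 < ‖Q‖) (z : 𝕜) :
    Tendsto (fun N : ℕ => z / Q ^ N) atTop (𝓝 0) := by
  have h : Tendsto (fun N : ℕ => Q⁻¹ ^ N) atTop (𝓝 0) :=
    tendsto_pow_atTop_nhds_zero_of_norm_lt_one (by rw [norm_inv]; exact inv_lt_one_of_one_lt₀ hQ)
  simpa [div_eq_mul_inv] using h.const_mul z

theorem summable_norm_eulerCoeff_mul_pow (hQ : 1 < ‖Q‖) (z : 𝕜) :
    Summable fun j => ‖eulerCoeff Q j * z ^ j‖ := by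
  have hratio : Tendsto (fun j : ℕ => ‖(1 - Q ^ (j + 1))⁻¹ * z‖) atTop (𝓝 0) := by
    have h : Tendsto (fun j : ℕ => Q ^ (j + 1)) atTop (Bornology.cobounded 𝕜) := by
      refine tendsto_norm_atTop_iff_cobounded.1 ?_
      simp_rw [norm_pow]
      exact (tendsto_add_atTop_iff_nat 1).2 (tendsto_pow_atTop_atTop_of_one_lt hQ)
    have h' := (tendsto_inv₀_cobounded.comp ((tendsto_const_sub_cobounded 1).comp h)).mul_const z
    simpa using h'.norm
  refine summable_of_ratio_norm_eventually_le one_half_lt_one ?_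
  filter_upwards [hratio.eventually_le_const one_half_pos] with j hj
  calc ‖‖eulerCoeff Q (j + 1) * z ^ (j + 1)‖‖
      = ‖(1 - Q ^ (j + 1))⁻¹ * z‖ * ‖‖eulerCoeff Q j * z ^ j‖‖ := by
        rw [norm_norm, norm_norm, ← norm_mul, eulerCoeff_succ]
        ring_nf
    _ ≤ 1 / 2 * ‖‖eulerCoeff Q j * z ^ j‖‖ := by gcongr

variable [CompleteSpace 𝕜]

theorem multipliable_one_sub_div_pow (hQ : 1 < ‖Q‖) (z : 𝕜) :
    Multipliable fun i : ℕ => 1 - z / Q ^ (i + 1) := by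
  have hgeom : Summable fun i : ℕ => ‖z‖ * ‖Q‖⁻¹ ^ (i + 1) :=
    ((summable_nat_add_iff 1).2 (summable_geometric_of_lt_one (inv_nonneg.2 (norm_nonneg Q))
      (inv_lt_one_of_one_lt₀ hQ))).mul_left _
  simp_rw [sub_eq_add_neg]
  refine multipliable_one_add_of_summable (hgeom.congr fun i => ?_)
  rw [norm_neg, norm_div, norm_pow, inv_pow, div_eq_mul_inv]

theorem tsum_eulerCoeff_mul_pow_eq_mul (hQ : 1 < ‖Q‖) (z : 𝕜) :
    ∑' j, eulerCoeff Q j * z ^ j = (1 - z / Q) * ∑' j, eulerCoeff Q j * (z / Q) ^ j := by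
  have hQ0 : Q ≠ 0 := norm_pos_iff.1 (zero_lt_one.trans hQ)
  have hs (w : 𝕜) := (summable_norm_eulerCoeff_mul_pow hQ w).of_norm
  rw [sub_mul, one_mul, ← tsum_mul_left, (hs z).tsum_eq_zero_add, (hs (z / Q)).tsum_eq_zero_add,
    add_sub_assoc, ← ((summable_nat_add_iff 1).2 (hs (z / Q))).tsum_sub ((hs (z / Q)).mul_left _)]
  refine congrArg₂ _ (by simp) (tsum_congr fun j => ?_)
  rw [← eulerCoeff_succ_mul (pow_succ_ne_one_of_one_lt_norm hQ) j, div_pow, div_pow]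
  field_simp
  ring

theorem tsum_eulerCoeff_mul_pow_eq_prod_mul (hQ : 1 < ‖Q‖) (z : 𝕜) (N : ℕ) :
    ∑' j, eulerCoeff Q j * z ^ j =
      (∏ i ∈ Finset.range N, (1 - z / Q ^ (i + 1))) *
        ∑' j, eulerCoeff Q j * (z / Q ^ N) ^ j := by
  induction N with
  | zero => simp
  | succ N ih =>
    rw [ih, tsum_eulerCoeff_mul_pow_eq_mul hQ, Finset.prod_range_succ, mul_assoc, div_div,
      ← pow_succ]

theorem tendsto_tsum_eulerCoeff_mul_div_pow (hQ : 1 < ‖Q‖) (z : 𝕜) :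
    Tendsto (fun N : ℕ => ∑' j, eulerCoeff Q j * (z / Q ^ N) ^ j) atTop (𝓝 1) := by
  have hval : ∑' j, eulerCoeff Q j * (0 : 𝕜) ^ j = 1 := by
    rw [tsum_eq_single 0 fun j hj => by rw [zero_pow hj, mul_zero], pow_zero, mul_one,
      eulerCoeff_zero]
  rw [← hval]
  refine tendsto_tsum_of_dominated_convergence (summable_norm_eulerCoeff_mul_pow hQ z)
    (fun j => ((tendsto_div_pow_atTop_nhds_zero hQ z).pow j).const_mul _)
    (Eventually.of_forall fun N j => ?_)
  rw [norm_mul, norm_mul, norm_pow, norm_pow, norm_div, norm_pow]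
  gcongr
  exact div_le_self (norm_nonneg z) (one_le_pow₀ hQ.le)

theorem tsum_eulerCoeff_mul_pow (hQ : 1 < ‖Q‖) (z : 𝕜) :
    ∑' j, eulerCoeff Q j * z ^ j = ∏' i : ℕ, (1 - z / Q ^ (i + 1)) := by
  have h := (multipliable_one_sub_div_pow hQ z).tendsto_prod_tprod_nat.mul
    (tendsto_tsum_eulerCoeff_mul_div_pow hQ z)
  rw [mul_one] at h
  exact tendsto_nhds_unique
    (tendsto_const_nhds.congr (tsum_eulerCoeff_mul_pow_eq_prod_mul hQ z)) h

end NormedField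

end EulerSeries

section ProductOfSeries

variable {ι κ R : Type*} [Fintype ι] [NormedCommRing R] [NormOneClass R]

open Classical in
theorem tendsto_piFinset_const_atTop :
    Tendsto (fun s : Finset κ => Fintype.piFinset fun _ : ι => s) atTop atTop :=
  tendsto_atTop_finset_of_monotone
    (fun _ _ h => Fintype.piFinset_subset _ _ fun _ => h)
    fun j => ⟨Finset.univ.image j, Fintype.mem_piFinset.2 fun a =>
      Finset.mem_image_of_mem j (Finset.mem_univ a)⟩

theorem summable_norm_prod_pi {c : ι → κ → R} (hc : ∀ a, Summable fun k => ‖c a k‖) :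
    Summable fun j : ι → κ => ‖∏ a, c a (j a)‖ := by
  classical
  refine summable_of_sum_le (c := ∏ a, ∑' k, ‖c a k‖) (fun _ => norm_nonneg _) fun u => ?_
  obtain ⟨s, hs⟩ := (tendsto_piFinset_const_atTop.eventually_ge_atTop u).exists
  calc ∑ j ∈ u, ‖∏ a, c a (j a)‖
      ≤ ∑ j ∈ Fintype.piFinset fun _ : ι => s, ‖∏ a, c a (j a)‖ :=
        Finset.sum_le_sum_of_subset_of_nonneg hs fun _ _ _ => norm_nonneg _
    _ ≤ ∑ j ∈ Fintype.piFinset fun _ : ι => s, ∏ a, ‖c a (j a)‖ :=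
        Finset.sum_le_sum fun _ _ => Finset.norm_prod_le _ _
    _ = ∏ a, ∑ k ∈ s, ‖c a k‖ := (Finset.prod_univ_sum _ fun a k => ‖c a k‖).symm
    _ ≤ ∏ a, ∑' k, ‖c a k‖ :=
        Finset.prod_le_prod (fun _ _ => Finset.sum_nonneg fun _ _ => norm_nonneg _)
          fun a _ => (hc a).sum_le_tsum _ fun _ _ => norm_nonneg _

variable [CompleteSpace R]

theorem tsum_prod_pi {c : ι → κ → R} (hc : ∀ a, Summable fun k => ‖c a k‖) :
    ∑' j : ι → κ, ∏ a, c a (j a) = ∏ a, ∑' k, c a k := by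
  classical
  have hbox := (summable_norm_prod_pi hc).of_norm.hasSum.comp tendsto_piFinset_const_atTop
  have hprod : Tendsto (fun s => ∏ a, ∑ k ∈ s, c a k) atTop (𝓝 (∏ a, ∑' k, c a k)) :=
    tendsto_finsetProd _ fun a _ => (hc a).of_norm.hasSum
  exact tendsto_nhds_unique hbox (hprod.congr fun _ => Finset.prod_univ_sum _ _)

end ProductOfSeries

section GroupAction

variable {G X : Type*} [Group G]

theorem natCard_sigma_smul_eq_map [MulAction G X] [Nonempty X] {H : Subgroup G}
    [MulAction.IsPretransitive H X] {C : Set G} (hC : ∀ h ∈ H, ∀ g ∈ C, h * g ∈ C) (σ : X → X) :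
    Nat.card (Σ g : C, {x : X // (g : G) • x = σ x}) = Nat.card C := by
  let x₀ : X := Classical.arbitrary X
  choose d hd using fun x => MulAction.exists_smul_eq H (σ x) x₀
  have hd (x : X) : (d x : G) • σ x = x₀ := hd x
  -- The pair `(g, x)` is recovered from `d x * g`, since `(d x * g) • x = x₀`.
  refine Nat.card_eq_of_bijective
    (fun p => ⟨d p.2.1 * p.1, hC _ (d p.2.1).2 _ p.1.2⟩) ⟨?_, ?_⟩
  · rintro ⟨g, x, hx⟩ ⟨g', x', hx'⟩ h
    have h : (d x * g : G) = d x' * g' := congrArg Subtype.val h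
    obtain rfl : x = x' := by
      rw [eq_inv_smul_iff.2 (show (d x * g : G) • x = x₀ by rw [mul_smul, hx, hd]), h,
        inv_smul_eq_iff, mul_smul, hx', hd]
    obtain rfl : g = g' := Subtype.ext (mul_left_cancel h)
    rfl
  · rintro ⟨k, hk⟩
    refine ⟨⟨⟨(d (k⁻¹ • x₀) : G)⁻¹ * k, hC _ (H.inv_mem (d _).2) _ hk⟩, k⁻¹ • x₀, ?_⟩,
      Subtype.ext (mul_inv_cancel_left _ _)⟩
    rw [mul_smul, smul_inv_smul, inv_smul_eq_iff, hd]

variable [Finite X]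

theorem sum_natCard_smul_eq_map [MulAction G X] [Nonempty X] {H : Subgroup G}
    [MulAction.IsPretransitive H X] {C : Finset G} (hC : ∀ h ∈ H, ∀ g ∈ C, h * g ∈ C)
    (σ : X → X) :
    ∑ g ∈ C, Nat.card {x : X // g • x = σ x} = C.card := by
  rw [← Finset.sum_coe_sort, ← Nat.card_sigma, ← Fintype.card_coe, ← Nat.card_eq_fintype_card]
  exact natCard_sigma_smul_eq_map (C := (C : Set G)) hC σ

theorem sum_natCard_smul_eq_map_le [Finite G] [MulAction G X] [MulAction.IsPretransitive G X]
    (C : Finset G) (σ : X → X) :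
    ∑ g ∈ C, Nat.card {x : X // g • x = σ x} ≤ Nat.card G := by
  have := Fintype.ofFinite G
  cases isEmpty_or_nonempty X
  · simp
  have : MulAction.IsPretransitive (⊤ : Subgroup G) X :=
    ⟨fun x y => (MulAction.exists_smul_eq G x y).imp' (fun g => ⟨g, trivial⟩) fun _ h => h⟩
  calc ∑ g ∈ C, Nat.card {x : X // g • x = σ x}
      ≤ ∑ g, Nat.card {x : X // g • x = σ x} := Finset.sum_le_univ_sum_of_nonneg fun _ => zero_le
    _ = Nat.card G := by
      rw [sum_natCard_smul_eq_map (H := ⊤) (fun _ _ _ _ => Finset.mem_univ _), Finset.card_univ,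
        Nat.card_eq_fintype_card]

theorem natCard_le_index_mul_card {H : Subgroup G} {C : Finset G} (hne : C.Nonempty)
    (hC : ∀ h ∈ H, ∀ g ∈ C, h * g ∈ C) : Nat.card G ≤ H.index * C.card := by
  obtain ⟨g, hg⟩ := hne
  rw [← H.card_mul_index, mul_comm, ← Fintype.card_coe, ← Nat.card_eq_fintype_card]
  exact Nat.mul_le_mul_left _ (Nat.card_le_card_of_injective
    (fun h : H => (⟨h * g, hC _ h.2 _ hg⟩ : C))
    fun _ _ h => Subtype.ext (mul_right_cancel (congrArg Subtype.val h)))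

end GroupAction

section Embeddings

open Module Submodule

/-- The number of `R`-linear embeddings of `N` into `M`, or `0` if there are infinitely many. -/
noncomputable def numEmbeddings (R N M : Type*) [Ring R] [AddCommGroup N] [Module R N]
    [AddCommGroup M] [Module R M] : ℕ :=
  Nat.card {f : N →ₗ[R] M // Function.Injective f}

theorem numEmbeddings_pi_eq_prod {A K V : Type*} [CommRing A] [Field K] [Finite K]
    [AddCommGroup V] [Module K V] [Module.Finite K V] (j : ℕ) :
    (numEmbeddings K (Fin j → K) V : A) =
      ∏ i ∈ Finset.range j, ((Nat.card K : A) ^ finrank K V - (Nat.card K : A) ^ i) := by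
  have := Fintype.ofFinite K
  have : Finite V := Module.finite_of_finite K
  have hcard : numEmbeddings K (Fin j → K) V =
      Nat.card {v : Fin j → V // LinearIndependent K v} :=
    Nat.card_congr ((piEquiv (Fin j) K V).toEquiv.subtypeEquiv fun v => by
      rw [linearIndependent_iff_injective_fintypeLinearCombination]
      exact iff_of_eq <| congrArg _ <| funext fun w =>
        (piEquiv_apply_apply (Fin j) K V v w).symm).symm
  rw [hcard]
  rcases le_or_gt j (finrank K V) with hj | hj
  · rw [card_linearIndependent hj, Finset.prod_range, Nat.cast_prod]
    refine Finset.prod_congr rfl fun i _ => ?_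
    rw [← Nat.card_eq_fintype_card,
      Nat.cast_sub (Nat.pow_le_pow_right Nat.card_pos (i.2.le.trans hj)), Nat.cast_pow,
      Nat.cast_pow]
  · have : IsEmpty {v : Fin j → V // LinearIndependent K v} :=
      ⟨fun v => hj.not_ge (by simpa using v.2.fintype_card_le_finrank)⟩
    rw [Nat.card_of_isEmpty, Nat.cast_zero, prod_range_pow_sub_pow_eq_zero _ hj]

variable {R M : Type*} [CommRing R] [AddCommGroup M] [Module R M]

theorem numEmbeddings_eq_torsionBySet (I : Ideal R) (N : Type*) [AddCommGroup N] [Module R N]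
    [Module (R ⧸ I) N] [IsScalarTower R (R ⧸ I) N] :
    numEmbeddings R N M = numEmbeddings (R ⧸ I) N (torsionBySet R M I) := by
  have hsurj : Function.Surjective (algebraMap R (R ⧸ I)) := Ideal.Quotient.mk_surjective
  have hmem (f : N →ₗ[R] M) (x : N) : f x ∈ torsionBySet R M I := by
    refine (mem_torsionBySet_iff _ _).2 fun a => ?_
    rw [← map_smul, ← algebraMap_smul (R ⧸ I) a.1 x,
      show algebraMap R (R ⧸ I) a = 0 from Ideal.Quotient.eq_zero_iff_mem.2 a.2, zero_smul,
      map_zero]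
  exact Nat.card_congr
    { toFun := fun f => ⟨(f.1.codRestrict _ (hmem f.1)).extendScalarsOfSurjective hsurj,
        fun _ _ h => f.2 (congrArg Subtype.val h)⟩
      invFun := fun g => ⟨(torsionBySet R M I).subtype ∘ₗ g.1.restrictScalars R,
        Subtype.val_injective.comp g.2⟩
      left_inv := fun _ => rfl
      right_inv := fun _ => rfl }

variable {ι : Type*} {I : ι → Ideal R}

/-- The module `∏_i (R ⧸ I i) ^ (j i)`. -/
abbrev PiQuotient (I : ι → Ideal R) (j : ι → ℕ) : Type _ :=
  ∀ i, Fin (j i) → R ⧸ I i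

variable [Fintype ι]

theorem injective_lsum_iff [DecidableEq ι] (hI : Pairwise fun i k => I i ⊔ I k = ⊤)
    {N : ι → Type*} [∀ i, AddCommGroup (N i)] [∀ i, Module R (N i)]
    (hN : ∀ i, IsTorsionBySet R (N i) (I i)) (f : ∀ i, N i →ₗ[R] M) :
    Function.Injective (LinearMap.lsum R N R f) ↔ ∀ i, Function.Injective (f i) := by
  refine ⟨fun h i x y hxy => Pi.single_injective i (h ?_), fun h => ?_⟩
  · rw [LinearMap.lsum_piSingle, LinearMap.lsum_piSingle, hxy]
  have hindep : iSupIndep fun i => torsionBySet R M (I i : Set R) :=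
    (supIndep_torsionBySet_ideal (S := Finset.univ) fun i _ k _ hik => hI hik).iSupIndep_of_univ
  rw [injective_iff_map_eq_zero]
  intro x hx
  rw [LinearMap.lsum_apply, LinearMap.sum_apply] at hx
  funext i
  refine (injective_iff_map_eq_zero (f i)).1 (h i) _ <|
    (iSupIndep_iff_finsetSum_eq_zero_imp_eq_zero _).1 hindep Finset.univ (fun k => f k (x k))
      (fun k _ => ?_) hx i (Finset.mem_univ i)
  refine (mem_torsionBySet_iff _ _).2 fun a => ?_
  rw [← map_smul, @hN k (x k) a, map_zero]

theorem numEmbeddings_pi_of_isTorsionBySet (hI : Pairwise fun i k => I i ⊔ I k = ⊤)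
    {N : ι → Type*} [∀ i, AddCommGroup (N i)] [∀ i, Module R (N i)]
    (hN : ∀ i, IsTorsionBySet R (N i) (I i)) :
    numEmbeddings R (∀ i, N i) M = ∏ i, numEmbeddings R (N i) M := by
  classical
  rw [numEmbeddings, Nat.card_congr ((LinearMap.lsum R N R).toEquiv.subtypeEquiv fun f =>
    (injective_lsum_iff hI hN f).symm).symm, Nat.card_congr (Equiv.subtypePiEquivPi
      (p := fun i (g : N i →ₗ[R] M) => Function.Injective g)), Nat.card_pi]
  rfl

variable [Finite M] [∀ i, (I i).IsMaximal] [∀ i, Finite (R ⧸ I i)]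

theorem numEmbeddings_piQuotient {A : Type*} [CommRing A]
    (hI : Pairwise fun i k => I i ⊔ I k = ⊤) (j : ι → ℕ) :
    (numEmbeddings R (PiQuotient I j) M : A) = ∏ i, ∏ k ∈ Finset.range (j i),
      ((Nat.card (R ⧸ I i) : A) ^ finrank (R ⧸ I i) (torsionBySet R M (I i)) -
        (Nat.card (R ⧸ I i) : A) ^ k) := by
  have hquot (i : ι) : IsTorsionBySet R (R ⧸ I i) (I i) :=
    (isTorsionBySet_quotient_iff (I i) (I i)).2 fun _ _ h => (I i).mul_mem_right _ h
  have htors (i : ι) : IsTorsionBySet R (Fin (j i) → R ⧸ I i) (I i) := fun x a =>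
    funext fun k => @hquot i (x k) a
  rw [numEmbeddings_pi_of_isTorsionBySet hI htors, Nat.cast_prod]
  refine Finset.prod_congr rfl fun i _ => ?_
  let : Field (R ⧸ I i) := Ideal.Quotient.field (I i)
  rw [numEmbeddings_eq_torsionBySet (I i), numEmbeddings_pi_eq_prod]

open Classical in
theorem hasSum_prod_eulerCoeff_mul_numEmbeddings (hI : Pairwise fun i k => I i ⊔ I k = ⊤) :
    HasSum (fun j : ι → ℕ => (∏ i, eulerCoeff (Nat.card (R ⧸ I i) : ℝ) (j i)) *
        numEmbeddings R (PiQuotient I j) M)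
      (if ∀ i, torsionBySet R M (I i : Set R) = ⊥ then 1 else 0) := by
  let r (i : ι) := finrank (R ⧸ I i) (torsionBySet R M (I i))
  let c (i : ι) (k : ℕ) : ℝ := eulerCoeff (Nat.card (R ⧸ I i) : ℝ) k *
    ∏ l ∈ Finset.range k, ((Nat.card (R ⧸ I i) : ℝ) ^ r i - (Nat.card (R ⧸ I i) : ℝ) ^ l)
  have hr (i : ι) : r i = 0 ↔ torsionBySet R M (I i : Set R) = ⊥ := by
    let : Field (R ⧸ I i) := Ideal.Quotient.field (I i)
    rw [finrank_zero_iff, subsingleton_iff_eq_bot]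
  have hc (i : ι) : HasSum (c i) (if r i = 0 then 1 else 0) :=
    hasSum_eulerCoeff_mul_prod_pow (pow_succ_ne_one_of_one_lt_norm <| by
      rw [Real.norm_natCast]
      exact_mod_cast Finite.one_lt_card) (r i)
  have hprod : HasSum (fun j : ι → ℕ => ∏ i, c i (j i)) (∏ i, if r i = 0 then 1 else 0) := by
    have hnorm (i : ι) : Summable fun k => ‖c i k‖ := (hc i).summable.norm
    rw [← Finset.prod_congr rfl fun i _ => (hc i).tsum_eq, ← tsum_prod_pi hnorm]
    exact (summable_norm_prod_pi hnorm).of_norm.hasSum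
  simp_rw [Fintype.prod_boole, hr] at hprod
  convert hprod using 2 with j
  rw [numEmbeddings_piQuotient hI, ← Finset.prod_mul_distrib]

end Embeddings

section InjectiveMaps

open Module Polynomial

/-- The injective `R`-linear maps `U → V`, on which `G` acts by post-composition. -/
def injectiveMaps (G R U V : Type*) [Semiring R] [AddCommMonoid U] [Module R U] [AddCommMonoid V]
    [Module R V] [Group G] [DistribMulAction G V] [SMulCommClass R G V] :
    SubMulAction G (U →ₗ[R] V) where
  carrier := {f | Function.Injective f}
  smul_mem' g _ hf := (MulAction.injective g).comp hf

instance finite_injectiveMaps {G R U V : Type*} [Semiring R] [AddCommMonoid U] [Module R U]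
    [AddCommMonoid V] [Module R V] [Group G] [DistribMulAction G V] [SMulCommClass R G V]
    [Finite U] [Finite V] : Finite (injectiveMaps G R U V) :=
  have : Finite (U →ₗ[R] V) := DFunLike.finite _
  Subtype.finite

/-- Pre-composition of injective maps with multiplication by `X`. -/
noncomputable def injectiveMaps.precompX {G R N V : Type*} [CommSemiring R] [AddCommMonoid N]
    [Module R N] [Module R[X] N] [IsScalarTower R R[X] N] [AddCommMonoid V] [Module R V] [Group G]
    [DistribMulAction G V] [SMulCommClass R G V] (hX : IsSMulRegular N (X : R[X]))
    (f : injectiveMaps G R N V) : injectiveMaps G R N V :=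
  ⟨f.1 ∘ₗ Algebra.lsmul R R N (X : R[X]), f.2.comp hX⟩

theorem numEmbeddings_aeval_units {R A N V : Type*} [CommRing R] [Ring A] [Algebra R A]
    [AddCommGroup V] [Module R V] [Module A V] [IsScalarTower R A V] [AddCommGroup N] [Module R N]
    [Module R[X] N] [IsScalarTower R R[X] N] (hX : IsSMulRegular N (X : R[X])) (a : Aˣ) :
    numEmbeddings R[X] N (AEval R V (a : A)) =
      Nat.card {f : injectiveMaps Aˣ R N V // a • f = injectiveMaps.precompX hX f} := by
  let e := AEval.of R V (a : A)
  refine Nat.card_congr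
    { toFun := fun f => ⟨⟨e.symm.toLinearMap ∘ₗ f.1.restrictScalars R, e.symm.injective.comp f.2⟩,
        Subtype.ext (LinearMap.ext fun x => ?_)⟩
      invFun := fun f => ⟨LinearMap.ofAEval X (e.toLinearMap ∘ₗ f.1.1) (fun x => ?_) ∘ₗ
        (LinearEquiv.ofAEval X (LinearEquiv.refl R N) fun _ => rfl).symm.toLinearMap,
        e.injective.comp f.1.2⟩
      left_inv := fun _ => rfl
      right_inv := fun _ => rfl }
  · exact ((congrArg e.symm (f.1.map_smul X x)).trans (AEval.of_symm_X_smul (R := R) _ _)).symm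
  · refine Eq.trans ?_ (AEval.X_smul_of (R := R) (a : A) (f.1.1 x)).symm
    exact congrArg e (LinearMap.congr_fun (congrArg Subtype.val f.2) x).symm

end InjectiveMaps

section Transitivity

open Module

variable {F U V : Type*} [Field F] [AddCommGroup U] [Module F U] [AddCommGroup V] [Module F V]
  [FiniteDimensional F V] {f g : U →ₗ[F] V}

theorem exists_linearEquiv_comp_eq (hf : Function.Injective f) (hg : Function.Injective g) :
    ∃ e : V ≃ₗ[F] V, e.toLinearMap ∘ₗ f = g := by
  obtain ⟨e, he⟩ := Submodule.exists_linearEquiv_restrict_eq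
    ((LinearEquiv.ofInjective f hf).symm.trans (LinearEquiv.ofInjective g hg))
  refine ⟨e, LinearMap.ext fun x => ?_⟩
  have hx := he (LinearEquiv.ofInjective f hf x)
  rw [LinearEquiv.trans_apply, LinearEquiv.symm_apply_apply] at hx
  exact hx.symm

theorem exists_linearEquiv_det_eq_comp_eq_self (hU : finrank F U < finrank F V)
    (hg : Function.Injective g) (d : Fˣ) :
    ∃ e : V ≃ₗ[F] V, LinearEquiv.det e = d ∧ e.toLinearMap ∘ₗ g = g := by
  have hlt : LinearMap.range g < ⊤ := by
    refine lt_top_iff_ne_top.2 fun h => hU.ne ?_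
    rw [← LinearMap.finrank_range_of_inj hg, h, finrank_top]
  obtain ⟨ℓ, hℓ0, hℓ⟩ := Submodule.exists_le_ker_of_lt_top _ hlt
  obtain ⟨v, hv⟩ : ∃ v, ℓ v ≠ 0 := by
    by_contra! h
    exact hℓ0 (LinearMap.ext h)
  -- `s` fixes `ker ℓ`, which contains the range of `g`, and scales `V ⧸ ker ℓ` by `d`.
  let s := LinearMap.transvection ℓ (((d - 1 : F) / ℓ v) • v)
  have hdet : LinearMap.det s = d := by
    rw [LinearMap.transvection.det, map_smul, smul_eq_mul, div_mul_cancel₀ _ hv,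
      add_sub_cancel]
  refine ⟨LinearMap.equivOfDetNeZero s (hdet ▸ d.ne_zero), Units.ext ?_,
    LinearMap.ext fun x => ?_⟩
  · rw [LinearEquiv.coe_det]
    exact hdet
  · have hx : ℓ (g x) = 0 := hℓ (LinearMap.mem_range_self g x)
    change s (g x) = g x
    rw [LinearMap.transvection.apply, hx, zero_smul, add_zero]

theorem exists_linearEquiv_det_eq_one_comp_eq (hU : finrank F U < finrank F V)
    (hf : Function.Injective f) (hg : Function.Injective g) :
    ∃ e : V ≃ₗ[F] V, LinearEquiv.det e = 1 ∧ e.toLinearMap ∘ₗ f = g := by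
  obtain ⟨e, he⟩ := exists_linearEquiv_comp_eq hf hg
  obtain ⟨s, hdet, hs⟩ := exists_linearEquiv_det_eq_comp_eq_self hU hg (LinearEquiv.det e)⁻¹
  refine ⟨e.trans s, ?_, ?_⟩
  · rw [LinearEquiv.det_trans, hdet, inv_mul_cancel]
  · rw [LinearEquiv.coe_trans, LinearMap.comp_assoc, he, hs]

theorem exists_gl_det_eq_smul_eq {ι : Type*} [Fintype ι] [DecidableEq ι]
    (e : (ι → F) ≃ₗ[F] (ι → F)) :
    ∃ A : GL ι F, Matrix.GeneralLinearGroup.det A = LinearEquiv.det e ∧ ∀ v, A • v = e v := by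
  obtain ⟨A, hA⟩ := Matrix.GeneralLinearGroup.toLin.surjective
    (LinearMap.GeneralLinearGroup.ofLinearEquiv e)
  have hAe : Matrix.toLin' (A : Matrix ι ι F) = e := congrArg Units.val hA
  refine ⟨A, Units.ext ?_, fun v => LinearMap.congr_fun hAe v⟩
  rw [Matrix.GeneralLinearGroup.val_det_apply, ← LinearMap.det_toLin', hAe, LinearEquiv.coe_det]

instance isPretransitive_injectiveMaps {ι : Type*} [Fintype ι] [DecidableEq ι] :
    MulAction.IsPretransitive (GL ι F) (injectiveMaps (GL ι F) F U (ι → F)) := by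
  refine ⟨fun f g => ?_⟩
  obtain ⟨e, he⟩ := exists_linearEquiv_comp_eq f.2 g.2
  obtain ⟨A, -, hA⟩ := exists_gl_det_eq_smul_eq e
  exact ⟨A, Subtype.ext (LinearMap.ext fun x => (hA _).trans (LinearMap.congr_fun he x))⟩

variable {n : ℕ}

theorem slSubgroup_eq_ker_det : slSubgroup n F = Matrix.GeneralLinearGroup.det.ker :=
  SetLike.coe_injective Matrix.SpecialLinearGroup.range_toGL

theorem mul_mem_smul_slSubgroup (g : GL (Fin n) F) :
    ∀ B ∈ slSubgroup n F, ∀ A ∈ g • (slSubgroup n F : Set (GL (Fin n) F)),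
      B * A ∈ g • (slSubgroup n F : Set (GL (Fin n) F)) := by
  intro B hB A hA
  rw [Set.mem_smul_set_iff_inv_smul_mem, SetLike.mem_coe, smul_eq_mul] at hA ⊢
  rw [slSubgroup_eq_ker_det, MonoidHom.mem_ker] at hA hB ⊢
  rw [map_mul, map_mul, hB, one_mul, ← map_mul, hA]

theorem isPretransitive_slSubgroup_injectiveMaps (hU : finrank F U < n) :
    MulAction.IsPretransitive (slSubgroup n F) (injectiveMaps (GL (Fin n) F) F U (Fin n → F)) := by
  refine ⟨fun f g => ?_⟩
  obtain ⟨e, hdet, he⟩ := exists_linearEquiv_det_eq_one_comp_eq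
    (by rwa [finrank_fin_fun]) f.2 g.2
  obtain ⟨A, hA_det, hA⟩ := exists_gl_det_eq_smul_eq e
  refine ⟨⟨A, ?_⟩, Subtype.ext (LinearMap.ext fun x => (hA _).trans (LinearMap.congr_fun he x))⟩
  rw [slSubgroup_eq_ker_det, MonoidHom.mem_ker, hA_det, hdet]

theorem nonempty_injectiveMaps [FiniteDimensional F U] (hU : finrank F U < n) :
    Nonempty (injectiveMaps (GL (Fin n) F) F U (Fin n → F)) := by
  obtain ⟨f, hf⟩ := Module.Free.exists_linearMap_injective_of_lift_rank_lt
    (R := F) (M := U) (N' := Fin n → F) (by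
      rw [← finrank_eq_rank, rank_fin_fun, Cardinal.lift_natCast, Cardinal.lift_natCast]
      exact_mod_cast hU)
  exact ⟨⟨f, hf⟩⟩

theorem index_slSubgroup_le [Finite F] : (slSubgroup n F).index ≤ Nat.card Fˣ := by
  rw [slSubgroup_eq_ker_det, Subgroup.index_ker]
  exact Subgroup.card_le_card_group _

end Transitivity
section Charpoly

open Module Polynomial

variable {F ι : Type*} [Field F] [Fintype ι] [DecidableEq ι] {A : Matrix ι ι F}

theorem isUnit_aeval_of_isCoprime_charpoly {p : F[X]} (h : IsCoprime p A.charpoly) :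
    IsUnit (aeval A p) := by
  obtain ⟨u, v, huv⟩ := h
  have hu : aeval A u * aeval A p = 1 := by
    rw [← map_mul, ← map_one (aeval A : F[X] →ₐ[F] _), ← huv, map_add, map_mul (aeval A) v,
      Matrix.aeval_self_charpoly, mul_zero, add_zero]
  exact IsUnit.of_mul_eq_one_right _ hu

theorem isCoprime_charpoly_of_isUnit_aeval {p : F[X]} (h : IsUnit (aeval A p)) :
    IsCoprime p A.charpoly := by
  let m : Matrix ι ι F →ₐ[F] Matrix ι ι (AlgebraicClosure F) :=
    (Algebra.ofId F (AlgebraicClosure F)).mapMatrix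
  rw [isCoprime_iff_aeval_ne_zero_of_isAlgClosed F (AlgebraicClosure F)]
  by_contra! hroot
  obtain ⟨α, hp, hA⟩ := hroot
  have hα : α ∈ spectrum (AlgebraicClosure F) (m A) := by
    rw [Matrix.mem_spectrum_iff_isRoot_charpoly, IsRoot.def]
    exact (congrArg _ (Matrix.charpoly_map A (algebraMap F (AlgebraicClosure F)))).trans
      ((eval_map_algebraMap _ _).trans hA)
  have hzero := spectrum.subset_polynomial_aeval (m A) (p.map (algebraMap F (AlgebraicClosure F)))
    ⟨α, hα, (eval_map_algebraMap _ _).trans hp⟩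
  rw [spectrum.zero_mem_iff, aeval_map_algebraMap, aeval_algHom_apply] at hzero
  exact hzero (h.map m)

theorem isUnit_aeval_iff_isCoprime_charpoly {p : F[X]} :
    IsUnit (aeval A p) ↔ IsCoprime p A.charpoly :=
  ⟨isCoprime_charpoly_of_isUnit_aeval, isUnit_aeval_of_isCoprime_charpoly⟩

theorem torsionBy_aeval_eq_bot_iff_isCoprime_charpoly {p : F[X]} :
    Submodule.torsionBy F[X] (AEval F (ι → F) A) p = ⊥ ↔ IsCoprime p A.charpoly := by
  rw [← isSMulRegular_iff_torsionBy_eq_bot, ← isUnit_aeval_iff_isCoprime_charpoly,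
    ← Matrix.mulVec_injective_iff_isUnit]
  exact Iff.rfl

end Charpoly

section SmallFactors

open Module Polynomial

/-- The monic irreducible polynomials of degree at most `t` with non-zero constant term: the monic
polynomials that `NoFactorOfDegreeLE t` has to exclude for an invertible matrix. -/
def smallIrred (F : Type*) [Field F] (t : ℕ) : Set F[X] :=
  {φ | φ.Monic ∧ Irreducible φ ∧ φ.natDegree ≤ t ∧ φ.coeff 0 ≠ 0}

variable {F : Type*} [Field F] {t : ℕ}

/-- The maximal ideal generated by a member of `smallIrred F t`. -/
noncomputable abbrev smallIrredIdeal (φ : smallIrred F t) : Ideal F[X] :=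
  Ideal.span {φ.1}

theorem finite_smallIrred [Finite F] : (smallIrred F t).Finite := by
  have : Finite (degreeLT F (t + 1)) := Finite.of_equiv _ (degreeLTEquiv F (t + 1)).toEquiv.symm
  refine (Set.toFinite (degreeLT F (t + 1) : Set F[X])).subset fun φ hφ => mem_degreeLT.2 ?_
  exact degree_le_natDegree.trans_lt (by exact_mod_cast Nat.lt_succ_of_le hφ.2.2.1)

noncomputable instance [Finite F] : Fintype (smallIrred F t) :=
  finite_smallIrred.fintype

instance (φ : smallIrred F t) : (smallIrredIdeal φ).IsMaximal :=
  PrincipalIdealRing.isMaximal_of_irreducible φ.2.2.1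

instance (φ : smallIrred F t) : Module.Finite F (F[X] ⧸ smallIrredIdeal φ) :=
  φ.2.1.finite_quotient

instance [Finite F] (φ : smallIrred F t) : Finite (F[X] ⧸ smallIrredIdeal φ) :=
  Module.finite_of_finite F

theorem natCard_quotient_smallIrredIdeal (φ : smallIrred F t) :
    Nat.card (F[X] ⧸ smallIrredIdeal φ) = Nat.card F ^ φ.1.natDegree := by
  rw [Module.natCard_eq_pow_finrank (K := F), finrank_quotient_span_eq_natDegree]

theorem pairwise_smallIrredIdeal_sup_eq_top :
    Pairwise fun φ ψ : smallIrred F t => smallIrredIdeal φ ⊔ smallIrredIdeal ψ = ⊤ := by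
  refine fun φ ψ h => Ideal.IsMaximal.coprime_of_ne inferInstance inferInstance fun hφψ => h ?_
  exact Subtype.ext <| eq_of_monic_of_associated φ.2.1 ψ.2.1 <|
    Ideal.span_singleton_eq_span_singleton.1 hφψ

theorem X_notMem_smallIrredIdeal (φ : smallIrred F t) : X ∉ smallIrredIdeal φ := fun h =>
  φ.2.2.2.2 <| X_dvd_iff.1 <|
    φ.2.2.1.dvd_symm irreducible_X (Ideal.mem_span_singleton.1 h)

variable {n : ℕ}

theorem X_not_dvd_charpoly (A : GL (Fin n) F) : ¬X ∣ A.val.charpoly := fun h => by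
  have hdet := (Matrix.isUnit_iff_isUnit_det _).1 A.isUnit
  rw [Matrix.det_eq_sign_charpoly_coeff, X_dvd_iff.1 h, mul_zero] at hdet
  exact not_isUnit_zero hdet

theorem noFactorOfDegreeLE_iff_isCoprime (A : GL (Fin n) F) :
    NoFactorOfDegreeLE t A ↔ ∀ φ : smallIrred F t, IsCoprime φ.1 A.val.charpoly := by
  classical
  refine ⟨fun h φ => φ.2.2.1.coprime_iff_not_dvd.2 fun hdvd =>
    (h φ φ.2.2.1 hdvd).not_ge φ.2.2.2.1, fun h φ hφ hdvd => ?_⟩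
  by_contra! hle
  have hass : Associated (normalize φ) φ := normalize_associated φ
  have hirr : Irreducible (normalize φ) := hass.symm.irreducible hφ
  have hdvd' : normalize φ ∣ A.val.charpoly := hass.dvd.trans hdvd
  have hmem : normalize φ ∈ smallIrred F t :=
    ⟨monic_normalize hφ.ne_zero, hirr, by rwa [natDegree_eq_of_degree_eq degree_normalize],
      fun h0 => X_not_dvd_charpoly A ((X_dvd_iff.2 h0).trans hdvd')⟩
  exact hirr.coprime_iff_not_dvd.1 (h ⟨_, hmem⟩) hdvd'

theorem noFactorOfDegreeLE_iff_torsionBySet_eq_bot (A : GL (Fin n) F) :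
    NoFactorOfDegreeLE t A ↔ ∀ φ : smallIrred F t, Submodule.torsionBySet F[X]
      (AEval F (Fin n → F) A.val) (smallIrredIdeal φ : Set F[X]) = ⊥ := by
  simp_rw [Submodule.torsionBySet_ideal_span_singleton_eq,
    torsionBy_aeval_eq_bot_iff_isCoprime_charpoly, noFactorOfDegreeLE_iff_isCoprime]

open Classical in
theorem hasSum_prod_eulerCoeff_mul_numEmbeddings_aeval [Finite F] (A : GL (Fin n) F) :
    HasSum (fun j : smallIrred F t → ℕ =>
        (∏ φ, eulerCoeff ((Nat.card F : ℝ) ^ φ.1.natDegree) (j φ)) *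
          numEmbeddings F[X] (PiQuotient smallIrredIdeal j) (AEval F (Fin n → F) A.val))
      (if NoFactorOfDegreeLE t A then 1 else 0) := by
  have : Finite (AEval F (Fin n → F) A.val) := Module.finite_of_finite F
  have h := hasSum_prod_eulerCoeff_mul_numEmbeddings
    (M := AEval F (Fin n → F) A.val)
    (pairwise_smallIrredIdeal_sup_eq_top (F := F) (t := t))
  simpa only [natCard_quotient_smallIrredIdeal, Nat.cast_pow,
    noFactorOfDegreeLE_iff_torsionBySet_eq_bot] using h

end SmallFactors

section MeanEmbeddings

open Module Polynomial
open scoped BigOperators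

theorem isSMulRegular_piQuotient {R ι : Type*} [CommRing R] {I : ι → Ideal R} [∀ i, (I i).IsPrime]
    {a : R} (ha : ∀ i, a ∉ I i) (j : ι → ℕ) : IsSMulRegular (PiQuotient I j) a := by
  refine IsSMulRegular.pi fun i => IsSMulRegular.pi fun _ => ?_
  rw [← isSMulRegular_algebraMap_iff (A := R ⧸ I i)]
  refine IsSMulRegular.of_ne_zero ?_
  exact Ideal.Quotient.eq_zero_iff_mem.not.2 (ha i)

variable {F N : Type*} [Field F] [Finite F] [AddCommGroup N] [Module F N] [Module.Finite F N]
  [Module F[X] N] [IsScalarTower F F[X] N] {n : ℕ} {C : Finset (GL (Fin n) F)}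

theorem sum_numEmbeddings_aeval (hX : IsSMulRegular N (X : F[X])) (hN : finrank F N < n)
    (hC : ∀ B ∈ slSubgroup n F, ∀ A ∈ C, B * A ∈ C) :
    ∑ A ∈ C, numEmbeddings F[X] N (AEval F (Fin n → F) A.val) = C.card := by
  have : Finite N := Module.finite_of_finite F
  have := nonempty_injectiveMaps hN
  have := isPretransitive_slSubgroup_injectiveMaps hN
  simp_rw [numEmbeddings_aeval_units hX]
  exact sum_natCard_smul_eq_map hC _

theorem sum_numEmbeddings_aeval_le (hX : IsSMulRegular N (X : F[X])) (C : Finset (GL (Fin n) F)) :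
    ∑ A ∈ C, numEmbeddings F[X] N (AEval F (Fin n → F) A.val) ≤
      Nat.card (GL (Fin n) F) := by
  have : Finite N := Module.finite_of_finite F
  simp_rw [numEmbeddings_aeval_units hX]
  exact sum_natCard_smul_eq_map_le C _

theorem expect_numEmbeddings_aeval (hX : IsSMulRegular N (X : F[X])) (hN : finrank F N < n)
    (hne : C.Nonempty) (hC : ∀ B ∈ slSubgroup n F, ∀ A ∈ C, B * A ∈ C) :
    𝔼 A ∈ C, (numEmbeddings F[X] N (AEval F (Fin n → F) A.val) : ℝ) = 1 := by
  rw [Finset.expect_eq_sum_div_card, ← Nat.cast_sum, sum_numEmbeddings_aeval hX hN hC,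
    div_self (Nat.cast_ne_zero.2 hne.card_ne_zero)]

theorem expect_numEmbeddings_aeval_le (hX : IsSMulRegular N (X : F[X]))
    (hne : C.Nonempty) (hC : ∀ B ∈ slSubgroup n F, ∀ A ∈ C, B * A ∈ C) :
    𝔼 A ∈ C, (numEmbeddings F[X] N (AEval F (Fin n → F) A.val) : ℝ) ≤ Nat.card Fˣ := by
  rw [Finset.expect_eq_sum_div_card, div_le_iff₀ (Nat.cast_pos.2 hne.card_pos)]
  exact_mod_cast (sum_numEmbeddings_aeval_le hX C).trans <|
    (natCard_le_index_mul_card hne hC).trans <| Nat.mul_le_mul_right _ index_slSubgroup_le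

end MeanEmbeddings

section Proportion

open Module Polynomial
open scoped BigOperators

variable {F : Type*} [Field F] {t : ℕ}

open Classical in
theorem proportion_coe_eq_expect {n : ℕ} (C : Finset (GL (Fin n) F)) :
    proportion t (C : Set (GL (Fin n) F)) =
      𝔼 A ∈ C, if NoFactorOfDegreeLE t A then 1 else 0 := by
  rw [proportion, Finset.expect_eq_sum_div_card, Finset.sum_boole, Set.ncard_coe_finset,
    ← Set.ncard_coe_finset (C.filter _), Finset.coe_filter]
  rfl

variable [Finite F]

theorem hasSum_proportion {n : ℕ} (C : Finset (GL (Fin n) F)) :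
    HasSum (fun j : smallIrred F t → ℕ =>
        (∏ φ, eulerCoeff ((Nat.card F : ℝ) ^ φ.1.natDegree) (j φ)) *
          𝔼 A ∈ C, (numEmbeddings F[X] (PiQuotient smallIrredIdeal j)
            (AEval F (Fin n → F) A.val) : ℝ))
      (proportion t (C : Set (GL (Fin n) F))) := by
  classical
  simp_rw [proportion_coe_eq_expect, Finset.expect_eq_sum_div_card, ← mul_div_assoc,
    Finset.mul_sum]
  exact (hasSum_sum fun A _ => hasSum_prod_eulerCoeff_mul_numEmbeddings_aeval A).div_const _

theorem one_lt_natCard_pow {j : ℕ} (hj : j ≠ 0) : 1 < ‖(Nat.card F : ℝ) ^ j‖ := by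
  rw [Real.norm_of_nonneg (by positivity)]
  exact one_lt_pow₀ (by exact_mod_cast Finite.one_lt_card) hj

theorem summable_norm_eulerCoeff_smallIrred (φ : smallIrred F t) :
    Summable fun k => ‖eulerCoeff ((Nat.card F : ℝ) ^ φ.1.natDegree) k‖ := by
  simpa only [one_pow, mul_one] using summable_norm_eulerCoeff_mul_pow
    (one_lt_natCard_pow (F := F) φ.2.2.1.natDegree_pos.ne') 1

theorem tendsto_proportion {C : (n : ℕ) → Set (GL (Fin n) F)} (hne : ∀ n, (C n).Nonempty)
    (hC : ∀ n, ∀ B ∈ slSubgroup n F, ∀ A ∈ C n, B * A ∈ C n) :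
    Tendsto (fun n => proportion t (C n)) atTop
      (𝓝 (∏ φ : smallIrred F t, ∑' k, eulerCoeff ((Nat.card F : ℝ) ^ φ.1.natDegree) k)) := by
  lift C to (n : ℕ) → Finset (GL (Fin n) F) using fun n => (C n).toFinite
  have hX (j : smallIrred F t → ℕ) : IsSMulRegular (PiQuotient smallIrredIdeal j) (X : F[X]) :=
    isSMulRegular_piQuotient X_notMem_smallIrredIdeal j
  have hsum := summable_norm_prod_pi (summable_norm_eulerCoeff_smallIrred (F := F) (t := t))
  simp_rw [← (hasSum_proportion _).tsum_eq, ← tsum_prod_pi summable_norm_eulerCoeff_smallIrred]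
  refine tendsto_tsum_of_dominated_convergence (hsum.mul_right (Nat.card Fˣ : ℝ)) (fun j => ?_)
    (.of_forall fun n j => ?_)
  · refine tendsto_const_nhds.congr' ?_
    filter_upwards [eventually_gt_atTop (finrank F (PiQuotient smallIrredIdeal j))] with n hn
    rw [expect_numEmbeddings_aeval (hX j) hn (hne n) (hC n), mul_one]
  · rw [norm_mul, Real.norm_of_nonneg (Finset.expect_nonneg fun _ _ => Nat.cast_nonneg _)]
    gcongr
    exact expect_numEmbeddings_aeval_le (hX j) (hne n) (hC n)

end Proportion

section LimitProduct

variable {F : Type*} [Field F] {t : ℕ}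

theorem limitFactor_succ (j i : ℕ) : limitFactor F j (i + 1) =
    (1 - 1 / ((Nat.card F : ℝ) ^ j) ^ (i + 1)) ^ numIrred F j := by
  rw [limitFactor, ← pow_mul, mul_comm]

variable [Finite F]

theorem multipliable_limitFactor {j : ℕ} (hj : j ≠ 0) :
    Multipliable fun i => limitFactor F j (i + 1) := by
  simp_rw [limitFactor_succ]
  exact (multipliable_one_sub_div_pow (one_lt_natCard_pow hj) 1).pow _

theorem tprod_limitFactor {j : ℕ} (hj : j ≠ 0) : ∏' i, limitFactor F j (i + 1) =
    (∑' k, eulerCoeff ((Nat.card F : ℝ) ^ j) k) ^ numIrred F j := by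
  have h := one_lt_natCard_pow (F := F) hj
  simp_rw [limitFactor_succ, (multipliable_one_sub_div_pow h 1).tprod_pow,
    ← tsum_eulerCoeff_mul_pow h, one_pow, mul_one]

open Classical in
theorem card_filter_smallIrred_natDegree_eq {j : ℕ} (hjt : j ≤ t) :
    (Finset.univ.filter fun φ : smallIrred F t => φ.1.natDegree = j).card = numIrred F j := by
  rw [numIrred, ← Set.ncard_coe_finset, ← Set.ncard_image_of_injective _ Subtype.val_injective]
  congr 1
  ext φ
  simp only [Finset.coe_filter, Finset.mem_univ, true_and, Set.mem_image, Set.mem_ofPred_eq,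
    Subtype.exists, exists_and_left, exists_prop, exists_eq_right_right]
  constructor
  · rintro ⟨hdeg, hmonic, hirr, -, h0⟩
    exact ⟨hmonic, hirr, hdeg, h0⟩
  · rintro ⟨hmonic, hirr, hdeg, h0⟩
    exact ⟨hdeg, hmonic, hirr, hdeg.trans_le hjt, h0⟩

theorem limitProduct_eq_prod_tsum_eulerCoeff : limitProduct F t =
    ∏ φ : smallIrred F t, ∑' k, eulerCoeff ((Nat.card F : ℝ) ^ φ.1.natDegree) k := by
  classical
  have hmaps : ∀ φ ∈ (Finset.univ : Finset (smallIrred F t)),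
      φ.1.natDegree ∈ Finset.Icc 1 t := fun φ _ =>
    Finset.mem_Icc.2 ⟨φ.2.2.1.natDegree_pos, φ.2.2.2.1⟩
  rw [← Finset.prod_fiberwise_of_maps_to hmaps, limitProduct]
  refine Finset.prod_congr rfl fun j hj => ?_
  obtain ⟨hj1, hjt⟩ := Finset.mem_Icc.1 hj
  rw [tprod_limitFactor (Nat.one_le_iff_ne_zero.1 hj1),
    Finset.prod_congr rfl fun φ hφ => by rw [(Finset.mem_filter.1 hφ).2], Finset.prod_const,
    card_filter_smallIrred_natDegree_eq hjt]

end LimitProduct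

theorem mainTheorem4 (F : Type*) [Field F] [Finite F] (t : ℕ) (ht : 1 ≤ t) :
    (∀ j ∈ Finset.Icc 1 t, Multipliable fun i : ℕ => limitFactor F j (i + 1)) ∧
    (∀ g : (n : ℕ) → GL (Fin n) F,
      Tendsto (fun n : ℕ => proportion t (g n • (slSubgroup n F : Set (GL (Fin n) F))))
        atTop (𝓝 (limitProduct F t))) ∧
    Tendsto (fun n : ℕ => proportion t (Set.univ : Set (GL (Fin n) F)))
      atTop (𝓝 (limitProduct F t)) := by
  rw [limitProduct_eq_prod_tsum_eulerCoeff]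
  refine ⟨fun j hj => ?_, fun g => ?_, ?_⟩
  · exact multipliable_limitFactor (Nat.one_le_iff_ne_zero.1 (Finset.mem_Icc.1 hj).1)
  · exact tendsto_proportion (fun n => (OneMemClass.coe_nonempty (slSubgroup n F)).smul_set)
      fun n => mul_mem_smul_slSubgroup (g n)
  · exact tendsto_proportion (fun _ => Set.univ_nonempty) fun _ _ _ _ _ => Set.mem_univ _
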